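/- A GF(2)-grammar is a quadruple $G=(\Sigma,N,R,S)$ consisting of a finite alphabet $\Sigma$, a finite set $N$ of nonterminal symbols, a finite set $R$ of rules $A\to X_1\odot\dots\odot X_\ell$ with $A\in N$, $\ell\ge 0$ and $X_1,\dots,X_\ell\in\Sigma\cup N$, and an initial symbol $S\in N$, such that in the corresponding ordinary (context-free) grammar $\widehat G$, with rules $A\to X_1\dots X_\ell$, every word $w\in\Sigma^*$ has only finitely many parse trees as $A$, for every $A\in N$. The language generated by $G$ is the set of all words $w\in\Sigma^*$ that have an odd number of parse trees as $S$ in $\widehat G$. An arithmetic progression is a set $\{c+kd : k\ge 0\}$ with integers $c,d\ge 0$; one-term progressions ($d=0$) are allowed. **Theorem.** Let $\mathbb N$ be either $\{0,1,2,\dots\}$ or $\{1,2,3,\dots\}$, let $a\ne b$ be two letters of a finite alphabet $\Sigma$, and let $f:\mathbb N\to\{0,1,2,\dots\}$ be strictly increasing. If the language $L_f=\{a^n b^{f(n)} : n\in\mathbb N\}\subseteq\Sigma^*$ is generated by a GF(2)-grammar over $\Sigma$, then the set $f(\mathbb N)$ is a finite union of arithmetic progressions. -/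

import Mathlib

/-- `ParseForest g [X₁, …, X_ℓ]` is the type of sequences of `ℓ` parse trees of the ordinary
(context-free) grammar `g`, the `i`-th tree having its root labelled by the symbol `X_i`:
a terminal labels a leaf, and a node labelled by a nonterminal `A` carries a rule `A → x` of `g`
together with a sequence of trees whose roots spell out `x`.
In particular `ParseForest g [.nonterminal A]` is the type of parse trees with root `A`. -/
inductive ParseForest {T : Type*} (g : ContextFreeGrammar T) : List (Symbol T g.NT) → Type _
  /-- The empty sequence of trees. -/
  | nil : ParseForest g []
  /-- The first tree is a leaf labelled by the terminal `t`. -/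
  | leaf (t : T) {s : List (Symbol T g.NT)} (rest : ParseForest g s) :
      ParseForest g (.terminal t :: s)
  /-- The root of the first tree is labelled by `A`; the rule `A → x` is applied there. -/
  | node (A : g.NT) (x : List (Symbol T g.NT)) (hx : ⟨A, x⟩ ∈ g.rules)
      (children : ParseForest g x) {s : List (Symbol T g.NT)} (rest : ParseForest g s) :
      ParseForest g (.nonterminal A :: s)

/-- The word spelled out by the leaves, read from left to right. -/
def ParseForest.yield {T : Type*} {g : ContextFreeGrammar T} :
    {s : List (Symbol T g.NT)} → ParseForest g s → List T
  | _, .nil => []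
  | _, .leaf t rest => t :: rest.yield
  | _, .node _ _ _ children rest => children.yield ++ rest.yield

/-- The parse trees of the word `w` as `A` in the ordinary grammar `g`. -/
def parseTrees {T : Type*} (g : ContextFreeGrammar T) (A : g.NT) (w : List T) :
    Set (ParseForest g [.nonterminal A]) :=
  {t | t.yield = w}

/-- A (well-formed) GF(2)-grammar. Syntactically it is the same as the ordinary grammar
`ordinary`; every word is required to have only finitely many parse trees in it. -/
structure GF2Grammar (T : Type*) where
  /-- The corresponding ordinary grammar. -/
  ordinary : ContextFreeGrammar T
  /-- Every word has only finitely many parse trees as each nonterminal. -/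
  finite_parseTrees : ∀ (A : ordinary.NT) (w : List T), (parseTrees ordinary A w).Finite

/-- The language `L_G(A)`: all words with an odd number of parse trees as `A`. -/
def GF2Grammar.languageOf {T : Type*} (G : GF2Grammar T) (A : G.ordinary.NT) : Language T :=
  {w | Odd (parseTrees G.ordinary A w).ncard}

/-- The language described by a GF(2)-grammar is that of its initial symbol. -/
def GF2Grammar.language {T : Type*} (G : GF2Grammar T) : Language T :=
  G.languageOf G.ordinary.initial

/-- The language `L` is described (generated) by some GF(2)-grammar. -/
def IsDescribedByGF2Grammar {T : Type*} (L : Language T) : Prop :=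
  ∃ G : GF2Grammar T, G.language = L

/-- The arithmetic progression `c, c + d, c + 2d, …`; for `d = 0` it is the single number `c`. -/
def arithmeticProgression (c d : ℕ) : Set ℕ :=
  {m | ∃ k : ℕ, m = c + k * d}

/-- `S` is the union of finitely many arithmetic progressions. (Since one-term progressions are
allowed, finite progressions are covered as well.) -/
def IsFiniteUnionOfArithmeticProgressions (S : Set ℕ) : Prop :=
  ∃ P : Finset (ℕ × ℕ), S = ⋃ p ∈ P, arithmeticProgression p.1 p.2

/-!
Let `F(x, y) = ∑ xⁿ y^f(n)` over the field with two elements; it counts the parse trees of the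
words `aⁿ bᵐ` modulo two. The series `p_X(x)` and `q_X(y)` that count the parse trees of the powers
of `a` and of `b` solve a polynomial system. Cutting a word `aⁿ bᵐ` in two inside either the first
or the second block shows that the part of positive degree in `y` of the series for `aⁿ bᵐ` solves
a linear system with coefficients polynomial in the `p_X` and `q_X`. A nonterminal that rewrites to
itself up to symbols deriving the empty word would have infinitely many parse trees, so at
`x = y = 0` the matrices of these systems are `1 - N` with `N` nilpotent. Hence all determinants are
nonzero, the `p_X` and `q_X` are algebraic, and `s F` is a finite sum of products `P(x) Q(y)` for
some nonzero polynomial `s(x, y)`.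

The rows of such a sum span a finite-dimensional space. As every row and column of `F` is finitely
supported, `s F` is a polynomial. So `F` is rational, and so is `F(1, y) = ∑ y^f(n)`; the
coefficients of a rational power series over a finite field are eventually periodic.
-/

/-- The right-hand sides `x` of the rules `A → x` of `g`. -/
abbrev RightHandSide {T : Type*} (g : ContextFreeGrammar T) (A : g.NT) :=
  {x : List (Symbol T g.NT) // ⟨A, x⟩ ∈ g.rules}

/-- The sequences of parse trees with roots `s` that spell out the word `w`. -/
abbrev Parses {T : Type*} (g : ContextFreeGrammar T) (s : List (Symbol T g.NT)) (w : List T) :=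
  {t : ParseForest g s // t.yield = w}

/-- The property required of the ordinary grammar underlying a GF(2)-grammar: each nonterminal
has only finitely many parse trees for each word. -/
class FinitelyAmbiguous {T : Type*} (g : ContextFreeGrammar T) : Prop where
  finite_parseTrees (A : g.NT) (w : List T) : (parseTrees g A w).Finite

instance {T : Type*} (G : GF2Grammar T) : FinitelyAmbiguous G.ordinary :=
  ⟨G.finite_parseTrees⟩

/-! ### Counting parse trees -/

namespace ParseForest

variable {T : Type*} {g : ContextFreeGrammar T}

instance : Subsingleton (ParseForest g []) where
  allEq | .nil, .nil => rfl

instance (t : T) : Subsingleton (ParseForest g [.terminal t]) where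
  allEq | .leaf _ .nil, .leaf _ .nil => rfl

/-- Juxtaposition of sequences of parse trees. -/
def append {s s' : List (Symbol T g.NT)} :
    ParseForest g s → ParseForest g s' → ParseForest g (s ++ s')
  | .nil, f => f
  | .leaf t rest, f => .leaf t (rest.append f)
  | .node A x hx children rest, f => .node A x hx children (rest.append f)

@[simp]
theorem yield_append {s s' : List (Symbol T g.NT)} (t : ParseForest g s)
    (t' : ParseForest g s') : (t.append t').yield = t.yield ++ t'.yield := by
  induction t with
  | nil => rfl
  | leaf t rest ih => simp [append, yield, ih]
  | node A x hx children rest _ ih => simp [append, yield, ih]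

/-- The number of inner nodes, that is, of applications of rules. -/
def size {s : List (Symbol T g.NT)} : ParseForest g s → ℕ
  | .nil => 0
  | .leaf _ rest => rest.size
  | .node _ _ _ children rest => children.size + rest.size + 1

@[simp]
theorem size_append {s s' : List (Symbol T g.NT)} (t : ParseForest g s)
    (t' : ParseForest g s') : (t.append t').size = t.size + t'.size := by
  induction t with
  | nil => simp [append, size]
  | leaf t rest ih => simp [append, size, ih]
  | node A x hx children rest _ ih => simp only [append, size, ih]; ring

/-- A nonempty sequence of trees amounts to its first tree and the remaining ones. -/
def consEquiv (X : Symbol T g.NT) (s : List (Symbol T g.NT)) :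
    ParseForest g (X :: s) ≃ ParseForest g [X] × ParseForest g s where
  toFun
    | .leaf t rest => (.leaf t .nil, rest)
    | .node A x hx children rest => (.node A x hx children .nil, rest)
  invFun p := p.1.append p.2
  left_inv
    | .leaf _ _ => rfl
    | .node _ _ _ _ _ => rfl
  right_inv
    | (.leaf _ .nil, _) => rfl
    | (.node _ _ _ _ .nil, _) => rfl

theorem yield_consEquiv_symm (X : Symbol T g.NT) (s : List (Symbol T g.NT))
    (p : ParseForest g [X] × ParseForest g s) :
    ((consEquiv X s).symm p).yield = p.1.yield ++ p.2.yield :=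
  yield_append p.1 p.2

end ParseForest

open ParseForest
open Finset.HasAntidiagonal (antidiagonal)

/-- Pairs of objects that spell out `w` together, sorted by the position at which `w` is cut. -/
def appendFiberEquiv {T α β : Type*} (u : α → List T) (v : β → List T) (w : List T) :
    {p : α × β // u p.1 ++ v p.2 = w} ≃
      Σ i : Fin (w.length + 1), {x : α // u x = w.take i} × {y : β // v y = w.drop i} where
  toFun p := ⟨⟨(u p.1.1).length, by
      have := congrArg List.length p.2
      rw [List.length_append] at this
      omega⟩,
    ⟨p.1.1, by simp [← p.2]⟩, ⟨p.1.2, by simp [← p.2]⟩⟩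
  invFun q := ⟨(q.2.1.1, q.2.2.1), by rw [q.2.1.2, q.2.2.2, List.take_append_drop]⟩
  left_inv _ := rfl
  right_inv := by
    rintro ⟨⟨i, hi⟩, ⟨x, hx⟩, ⟨y, hy⟩⟩
    have hlength : (u x).length = i := by rw [hx]; simp; omega
    subst hlength
    rfl

section Counting

variable {T : Type*} {g : ContextFreeGrammar T}

/-- Parses of a nonempty sequence of symbols, sorted by the word spelled out by the first tree. -/
def parsesConsEquiv (X : Symbol T g.NT) (s : List (Symbol T g.NT)) (w : List T) :
    Parses g (X :: s) w ≃
      Σ i : Fin (w.length + 1), Parses g [X] (w.take i) × Parses g s (w.drop i) :=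
  ((consEquiv X s).symm.subtypeEquiv fun p => by rw [yield_consEquiv_symm]).symm.trans
    (appendFiberEquiv yield yield w)

/-- Parses of a nonterminal, sorted by the rule applied at the root. -/
def parsesNonterminalEquiv (A : g.NT) (w : List T) :
    Parses g [.nonterminal A] w ≃ Σ x : RightHandSide g A, Parses g x.1 w where
  toFun
    | ⟨.node _ x hx children .nil, h⟩ => ⟨⟨x, hx⟩, children, by simpa [yield] using h⟩
  invFun p := ⟨.node A p.1.1 p.1.2 p.2.1 .nil, by simp [yield, p.2.2]⟩
  left_inv
    | ⟨.node _ _ _ _ .nil, _⟩ => rfl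
  right_inv _ := rfl

noncomputable instance (A : g.NT) : Fintype (RightHandSide g A) :=
  have : Finite (RightHandSide g A) :=
    Finite.of_injective (β := g.rules) (fun x => ⟨⟨A, x.1⟩, x.2⟩) fun x y h => by
      simpa [Subtype.ext_iff] using h
  Fintype.ofFinite _

instance finite_parses [FinitelyAmbiguous g] (s : List (Symbol T g.NT)) (w : List T) :
    Finite (Parses g s w) := by
  induction s generalizing w with
  | nil => infer_instance
  | cons X s ih =>
    have hX (w : List T) : Finite (Parses g [X] w) := by
      cases X with
      | terminal t => infer_instance
      | nonterminal A => exact (FinitelyAmbiguous.finite_parseTrees A w).to_subtype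
    exact Finite.of_equiv _ (parsesConsEquiv X s w).symm

/-- The number of sequences of parse trees with roots `s` that spell out `w`; its value is `0`
when there are infinitely many of them. -/
noncomputable def forestCount (g : ContextFreeGrammar T) (s : List (Symbol T g.NT))
    (w : List T) : ℕ :=
  Nat.card (Parses g s w)

theorem forestCount_of_subsingleton [DecidableEq T] {s : List (Symbol T g.NT)}
    [Subsingleton (ParseForest g s)] (t : ParseForest g s) (w : List T) :
    forestCount g s w = if w = t.yield then 1 else 0 := by
  split_ifs with h
  · exact Nat.card_eq_one_iff_unique.2 ⟨inferInstance, ⟨t, h.symm⟩⟩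
  · have : IsEmpty (Parses g s w) := ⟨fun p => h (by rw [← p.2, Subsingleton.elim t p.1])⟩
    exact Nat.card_of_isEmpty

theorem forestCount_nil (w : List T) : forestCount g [] w = if w = [] then 1 else 0 := by
  classical
  convert forestCount_of_subsingleton .nil w
  rfl

theorem forestCount_terminal [DecidableEq T] (t : T) (w : List T) :
    forestCount g [.terminal t] w = if w = [t] then 1 else 0 :=
  forestCount_of_subsingleton (.leaf t .nil) w

theorem forestCount_cons [FinitelyAmbiguous g] (X : Symbol T g.NT) (s : List (Symbol T g.NT))
    (w : List T) :
    forestCount g (X :: s) w = ∑ i ∈ Finset.range (w.length + 1),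
      forestCount g [X] (w.take i) * forestCount g s (w.drop i) := by
  rw [forestCount, Nat.card_congr (parsesConsEquiv X s w), Nat.card_sigma,
    ← Fin.sum_univ_eq_sum_range
      (fun i => forestCount g [X] (w.take i) * forestCount g s (w.drop i))]
  simp only [Nat.card_prod, forestCount]

theorem forestCount_nonterminal [FinitelyAmbiguous g] (A : g.NT) (w : List T) :
    forestCount g [.nonterminal A] w = ∑ x : RightHandSide g A, forestCount g x.1 w := by
  rw [forestCount, Nat.card_congr (parsesNonterminalEquiv A w), Nat.card_sigma]
  rfl

theorem forestCount_cons_replicate [FinitelyAmbiguous g] (X : Symbol T g.NT)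
    (s : List (Symbol T g.NT)) (a : T) (n : ℕ) :
    forestCount g (X :: s) (List.replicate n a) = ∑ ij ∈ antidiagonal n,
      forestCount g [X] (List.replicate ij.1 a) * forestCount g s (List.replicate ij.2 a) := by
  rw [forestCount_cons, Finset.Nat.sum_antidiagonal_eq_sum_range_succ_mk, List.length_replicate]
  refine Finset.sum_congr rfl fun i hi => ?_
  have hin : i ≤ n := Finset.mem_range_succ_iff.1 hi
  rw [List.take_replicate, List.drop_replicate, min_eq_left hin]

/-- The cut between the two blocks is counted in both sums on the right, hence the second term on
the left. -/
theorem forestCount_cons_replicate_append_replicate [FinitelyAmbiguous g] (X : Symbol T g.NT)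
    (s : List (Symbol T g.NT)) (a b : T) (n m : ℕ) :
    forestCount g (X :: s) (List.replicate n a ++ List.replicate m b) +
        forestCount g [X] (List.replicate n a) * forestCount g s (List.replicate m b) =
      ∑ ij ∈ antidiagonal n, forestCount g [X] (List.replicate ij.1 a) *
          forestCount g s (List.replicate ij.2 a ++ List.replicate m b) +
        ∑ ij ∈ antidiagonal m,
          forestCount g [X] (List.replicate n a ++ List.replicate ij.1 b) *
            forestCount g s (List.replicate ij.2 b) := by
  simp only [Finset.Nat.sum_antidiagonal_eq_sum_range_succ_mk]
  rw [forestCount_cons, List.length_append, List.length_replicate, List.length_replicate,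
    add_right_comm, Finset.sum_range_add, add_assoc, Finset.sum_range_succ' _ m]
  congr 1
  · refine Finset.sum_congr rfl fun i hi => ?_
    have hin : i ≤ n := Finset.mem_range_succ_iff.1 hi
    rw [List.take_append_of_le_length (by simpa), List.drop_append_of_le_length (by simpa),
      List.take_replicate, List.drop_replicate, min_eq_left hin]
  · congr 1
    · refine Finset.sum_congr rfl fun i hi => ?_
      have him : i + 1 ≤ m := Finset.mem_range.1 hi
      simp [List.take_append, List.drop_append, List.take_replicate, List.drop_replicate, him,
        show n + 1 + i - n = i + 1 by omega, show n ≤ n + 1 + i by omega,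
        show n - (n + 1 + i) = 0 by omega]
    · simp

theorem replicate_append_replicate_inj {a b : T} (hab : a ≠ b) {n m n' m' : ℕ} :
    List.replicate n a ++ List.replicate m b = List.replicate n' a ++ List.replicate m' b ↔
      n = n' ∧ m = m' := by
  classical
  refine ⟨fun h => ⟨?_, ?_⟩, by rintro ⟨rfl, rfl⟩; rfl⟩
  · simpa [List.count_replicate, hab.symm] using congrArg (List.count a) h
  · simpa [List.count_replicate, hab] using congrArg (List.count b) h

end Counting

section Nullability

variable {T : Type*} {g : ContextFreeGrammar T}

/-- The sequence `s` derives the empty word. -/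
def Nullable (g : ContextFreeGrammar T) (s : List (Symbol T g.NT)) : Prop :=
  Nonempty (Parses g s [])

theorem nullable_of_forestCount_ne_zero {s : List (Symbol T g.NT)}
    (h : forestCount g s [] ≠ 0) : Nullable g s :=
  (Nat.card_ne_zero.1 h).1

theorem nullable_of_forall_mem {s : List (Symbol T g.NT)} (h : ∀ X ∈ s, Nullable g [X]) :
    Nullable g s := by
  induction s with
  | nil => exact ⟨.nil, rfl⟩
  | cons X s ih =>
    obtain ⟨t, ht⟩ := h X List.mem_cons_self
    obtain ⟨t', ht'⟩ := ih fun Y hY => h Y (List.mem_cons_of_mem X hY)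
    exact ⟨(consEquiv X s).symm (t, t'), by rw [yield_consEquiv_symm, ht, ht', List.append_nil]⟩

/-- The nonterminals that have at least one parse tree. Unlike `g.NT`, this type is always
finite. -/
abbrev ProductiveNT (g : ContextFreeGrammar T) :=
  {A : g.NT // Nonempty (ParseForest g [.nonterminal A])}

noncomputable instance : Fintype (ProductiveNT g) :=
  have : Finite (ProductiveNT g) := by
    have (A : ProductiveNT g) : ∃ r : g.rules, r.1.input = A.1 := by
      obtain ⟨A, ⟨t⟩⟩ := A
      cases t with | node _ x hx => exact ⟨⟨_, hx⟩, rfl⟩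
    choose r hr using this
    exact Finite.of_injective r fun A B h => Subtype.ext (by rw [← hr, ← hr, h])
  Fintype.ofFinite _

theorem forestCount_of_isEmpty {A : g.NT} (hA : IsEmpty (ParseForest g [.nonterminal A]))
    (w : List T) : forestCount g [.nonterminal A] w = 0 := by
  rw [forestCount, Nat.card_of_isEmpty]

/-- `A` rewrites in one step to `B` surrounded by symbols deriving the empty word. -/
def UnitStep (g : ContextFreeGrammar T) (A B : g.NT) : Prop :=
  ∃ u v, ⟨A, u ++ .nonterminal B :: v⟩ ∈ g.rules ∧ Nullable g u ∧ Nullable g v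

theorem UnitStep.exists_larger_tree {A B : g.NT} (h : UnitStep g A B)
    (t : ParseForest g [.nonterminal B]) :
    ∃ t' : ParseForest g [.nonterminal A], t'.yield = t.yield ∧ t.size < t'.size := by
  obtain ⟨u, v, hr, ⟨tu, hu⟩, ⟨tv, hv⟩⟩ := h
  refine ⟨.node A _ hr (tu.append (t.append tv)) .nil, ?_, ?_⟩
  · simp [yield, hu, hv]
  · simp only [size, size_append]
    omega

theorem exists_larger_tree_of_transGen {A B : g.NT} (h : Relation.TransGen (UnitStep g) A B)
    (t : ParseForest g [.nonterminal B]) :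
    ∃ t' : ParseForest g [.nonterminal A], t'.yield = t.yield ∧ t.size < t'.size := by
  induction h using Relation.TransGen.head_induction_on with
  | single h => exact h.exists_larger_tree t
  | head h _ ih =>
    obtain ⟨t', hyield, hsize⟩ := ih
    obtain ⟨t'', hyield', hsize'⟩ := h.exists_larger_tree t'
    exact ⟨t'', hyield'.trans hyield, hsize.trans hsize'⟩

/-- Going around a cycle of unit steps would turn one parse tree into infinitely many. -/
theorem not_transGen_unitStep_self [FinitelyAmbiguous g] (A : ProductiveNT g) :
    ¬ Relation.TransGen (UnitStep g) A.1 A.1 := by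
  obtain ⟨A, ⟨t⟩⟩ := A
  intro h
  obtain ⟨m, hm, hmax⟩ := (FinitelyAmbiguous.finite_parseTrees A t.yield).exists_maximalFor
    ParseForest.size _ ⟨t, rfl⟩
  obtain ⟨t', hyield, hsize⟩ := exists_larger_tree_of_transGen h m
  exact hsize.not_ge (hmax (hyield.trans hm) hsize.le)

theorem wellFounded_unitStep [FinitelyAmbiguous g] :
    WellFounded fun B A : ProductiveNT g => UnitStep g A.1 B.1 := by
  let r : ProductiveNT g → ProductiveNT g → Prop :=
    fun B A => Relation.TransGen (UnitStep g) A.1 B.1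
  have : Std.Irrefl r := ⟨not_transGen_unitStep_self⟩
  have : IsTrans _ r := ⟨fun _ _ _ h h' => h'.trans h⟩
  exact Subrelation.wf Relation.TransGen.single (Finite.wellFounded_of_trans_of_irrefl r)

end Nullability

/-! ### Twisted derivations and the Jacobian of a grammar -/

section LeibnizSum

variable {σ A V : Type*} [CommRing A] [AddCommGroup V] [Module A V]

/-- The value at a word of the `(p, q)`-twisted derivation that takes the values `n` at the
letters, `∑ i, (∏ j < i, p (s j)) • (∏ j > i, q (s j)) • n (s i)`, as a linear function of `n`. -/
def leibnizSum (p q : σ → A) : List σ → (σ → V) →ₗ[A] V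
  | [] => 0
  | x :: s => (s.map q).prod • LinearMap.proj x + p x • leibnizSum p q s

@[simp]
theorem leibnizSum_nil (p q : σ → A) (n : σ → V) : leibnizSum p q [] n = 0 := rfl

theorem leibnizSum_cons (p q : σ → A) (x : σ) (s : List σ) (n : σ → V) :
    leibnizSum p q (x :: s) n = (s.map q).prod • n x + p x • leibnizSum p q s n := rfl

theorem map_leibnizSum {B : Type*} [CommRing B] (φ : A →+* B) (p q n : σ → A) (s : List σ) :
    φ (leibnizSum p q s n) = leibnizSum (φ ∘ p) (φ ∘ q) s (φ ∘ n) := by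
  induction s with
  | nil => simp
  | cons x s ih => simp [leibnizSum_cons, ih, map_list_prod]

theorem leibnizSum_mem (M : Submodule A V) (p q : σ → A) {n : σ → V} (hn : ∀ x, n x ∈ M)
    (s : List σ) : leibnizSum p q s n ∈ M := by
  induction s with
  | nil => exact M.zero_mem
  | cons x s ih => exact M.add_mem (M.smul_mem _ (hn x)) (M.smul_mem _ ih)

theorem leibnizSum_single [DecidableEq σ] (p q : σ → A) (y : σ) (v : V) (s : List σ) :
    leibnizSum p q s (Pi.single y v) = leibnizSum p q s (Pi.single y (1 : A)) • v := by
  induction s with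
  | nil => simp
  | cons x s ih =>
    have hx : (Pi.single y v : σ → V) x = (Pi.single y (1 : A) : σ → A) x • v := by
      obtain rfl | hxy := eq_or_ne x y
      · simp
      · simp [hxy]
    rw [leibnizSum_cons, leibnizSum_cons, ih, hx, smul_eq_mul, smul_eq_mul, add_smul, mul_smul,
      mul_smul]

theorem derivation_list_prod {k : Type*} [CommRing k] [Algebra k A] [Module k V]
    (D : Derivation k A V) (S : σ → A) (s : List σ) :
    D (s.map S).prod = leibnizSum S S s (D ∘ S) := by
  induction s with
  | nil => simp
  | cons x s ih =>
    rw [List.map_cons, List.prod_cons, D.leibniz, ih, leibnizSum_cons, add_comm,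
      Function.comp_apply]

theorem exists_split_of_leibnizSum_ne_zero [DecidableEq σ] {p q : σ → A}
    {y : σ} {s : List σ} (h : leibnizSum p q s (Pi.single y (1 : A)) ≠ 0) :
    ∃ u v, s = u ++ y :: v ∧ (∀ x ∈ u, p x ≠ 0) ∧ ∀ x ∈ v, q x ≠ 0 := by
  induction s with
  | nil => exact absurd rfl h
  | cons x s ih =>
    by_cases hrest : p x • leibnizSum p q s (Pi.single y (1 : A)) = 0
    · rw [leibnizSum_cons, hrest, add_zero, smul_eq_mul] at h
      obtain rfl : x = y := by
        by_contra hxy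
        exact h (by rw [Pi.single_eq_of_ne hxy, mul_zero])
      refine ⟨[], s, rfl, by simp, fun x hx h0 => left_ne_zero_of_mul h ?_⟩
      exact List.prod_eq_zero (List.mem_map.2 ⟨x, hx, h0⟩)
    · obtain ⟨u, v, rfl, hu, hv⟩ := ih (right_ne_zero_of_mul hrest)
      refine ⟨x :: u, v, rfl, ?_, hv⟩
      simpa using ⟨left_ne_zero_of_mul hrest, hu⟩

theorem det_smul_mem {ι : Type*} [Fintype ι] [DecidableEq ι] (B : Matrix ι ι A)
    (M : Submodule A V) {n : ι → V} (h : ∀ i, ∑ j, B i j • n j ∈ M) (i : ι) :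
    B.det • n i ∈ M := by
  have hadj : B.det • n i = ∑ l, B.adjugate i l • ∑ j, B l j • n j := by
    calc B.det • n i = ∑ j, (B.adjugate * B) i j • n j := by
          simp [Matrix.adjugate_mul, Matrix.smul_apply, Matrix.one_apply]
      _ = ∑ l, B.adjugate i l • ∑ j, B l j • n j := by
          simp only [Matrix.mul_apply, Finset.sum_smul, Finset.smul_sum, mul_smul]
          exact Finset.sum_comm
  rw [hadj]
  exact M.sum_mem fun l _ => M.smul_mem _ (h l)

end LeibnizSum

section Jacobian

open scoped Classical in
/-- The matrix of the linear system satisfied by the values at the productive nonterminals of a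
`(p, q)`-twisted derivation that is compatible with the rules of `g`. -/
noncomputable def jacobian {T : Type*} (g : ContextFreeGrammar T) {A : Type*} [CommRing A]
    (p q : Symbol T g.NT → A) : Matrix (ProductiveNT g) (ProductiveNT g) A :=
  fun X Y => ∑ x : RightHandSide g X.1, leibnizSum p q x.1 (Pi.single (.nonterminal Y.1) 1)

variable {T : Type*} {g : ContextFreeGrammar T}

open scoped Classical in
theorem map_det_one_sub_jacobian {A B : Type*} [CommRing A] [CommRing B] (φ : A →+* B)
    (p q : Symbol T g.NT → A) :
    φ (1 - jacobian g p q).det = (1 - jacobian g (φ ∘ p) (φ ∘ q)).det := by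
  have hJ : (jacobian g p q).map φ = jacobian g (φ ∘ p) (φ ∘ q) := by
    ext X Y
    simp only [Matrix.map_apply, jacobian, map_sum, map_leibnizSum]
    refine Finset.sum_congr rfl fun x _ => congrArg _ (funext fun Z => ?_)
    exact Pi.apply_single (fun _ => φ) (fun _ => map_zero φ) _ 1 Z |>.trans (by rw [map_one])
  rw [RingHom.map_det, map_sub, map_one, RingHom.mapMatrix_apply, hJ]

open scoped Classical in
/-- A nonzero entry of the Jacobian is witnessed by a unit step, so the matrix is triangular with
zero diagonal for a suitable order of the nonterminals. -/
theorem det_one_sub_jacobian_ne_zero [FinitelyAmbiguous g] {A : Type*} [CommRing A] [IsDomain A]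
    {p q : Symbol T g.NT → A} (hp : ∀ x, p x ≠ 0 → Nullable g [x])
    (hq : ∀ x, q x ≠ 0 → Nullable g [x]) : (1 - jacobian g p q).det ≠ 0 := by
  intro h
  obtain ⟨v, hv, h⟩ := Matrix.exists_mulVec_eq_zero_iff.2 h
  refine hv (funext fun X => ?_)
  induction X using (wellFounded_unitStep (g := g)).induction with
  | _ X ih =>
    have hX : v X = ∑ Y, jacobian g p q X Y * v Y := by
      have := congrFun h X
      rwa [Matrix.sub_mulVec, Matrix.one_mulVec, Pi.sub_apply, Pi.zero_apply, sub_eq_zero] at this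
    rw [hX]
    refine Finset.sum_eq_zero fun Y _ => ?_
    by_cases hXY : UnitStep g X.1 Y.1
    · rw [ih Y hXY, Pi.zero_apply, mul_zero]
    · rw [jacobian, Finset.sum_eq_zero, zero_mul]
      intro x _
      by_contra hx
      obtain ⟨u, w, hs, hu, hw⟩ := exists_split_of_leibnizSum_ne_zero hx
      exact hXY ⟨u, w, hs ▸ x.2, nullable_of_forall_mem fun y hy => hp y (hu y hy),
        nullable_of_forall_mem fun y hy => hq y (hw y hy)⟩

open scoped Classical in
/-- Splitting `n` into its values at the productive nonterminals and the rest, which lies in `M`,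
turns the equations into a linear system with right-hand sides in `M`. -/
theorem det_one_sub_jacobian_smul_mem {A V : Type*} [CommRing A] [AddCommGroup V] [Module A V]
    {p q : Symbol T g.NT → A} (M : Submodule A V) {n : Symbol T g.NT → V}
    (hn : ∀ X, n (.nonterminal X) = ∑ x : RightHandSide g X, leibnizSum p q x.1 n)
    (hterminal : ∀ t, n (.terminal t) ∈ M)
    (hempty : ∀ X, IsEmpty (ParseForest g [.nonterminal X]) → n (.nonterminal X) ∈ M)
    (x : Symbol T g.NT) : (1 - jacobian g p q).det • n x ∈ M := by
  obtain t | X := x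
  · exact M.smul_mem _ (hterminal t)
  obtain hX | hX := isEmpty_or_nonempty (ParseForest g [.nonterminal X])
  · exact M.smul_mem _ (hempty X hX)
  refine det_smul_mem (n := fun Y : ProductiveNT g => n (.nonterminal Y.1)) _ M (fun X => ?_)
    ⟨X, hX⟩
  let n' : Symbol T g.NT → V :=
    n - ∑ Y : ProductiveNT g, Pi.single (.nonterminal Y.1) (n (.nonterminal Y.1))
  have hn' (x : Symbol T g.NT) : n' x ∈ M := by
    obtain t | Z := x
    · simpa [n'] using hterminal t
    obtain hZ | hZ := isEmpty_or_nonempty (ParseForest g [.nonterminal Z])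
    · have hne (Y : ProductiveNT g) : Z ≠ Y.1 := by
        rintro rfl
        exact hZ.elim Y.2.some
      simpa [n', hne] using hempty Z hZ
    · have hsum : ∑ Y : ProductiveNT g,
          (Pi.single (.nonterminal Y.1) (n (.nonterminal Y.1)) : Symbol T g.NT → V)
            (.nonterminal Z) = n (.nonterminal Z) := by
        rw [Finset.sum_eq_single ⟨Z, hZ⟩ (fun Y _ hY => ?_) (by simp), Pi.single_eq_same]
        exact Pi.single_eq_of_ne (fun h => hY (Subtype.ext (Symbol.nonterminal.inj h).symm)) _
      simp [n', hsum]
  have hsystem : ∑ Y, (1 - jacobian g p q) X Y • n (.nonterminal Y.1) =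
      ∑ x : RightHandSide g X.1, leibnizSum p q x.1 n' := by
    have hone : ∑ Y, (1 : Matrix (ProductiveNT g) (ProductiveNT g) A) X Y • n (.nonterminal Y.1) =
        n (.nonterminal X.1) := by
      simp [Matrix.one_apply]
    simp only [Matrix.sub_apply, sub_smul, Finset.sum_sub_distrib, hone, n', map_sub, map_sum,
      ← hn, jacobian, Finset.sum_smul, leibnizSum_single p q _ (n _)]
    rw [Finset.sum_comm]
  rw [hsystem]
  exact M.sum_mem fun x _ => leibnizSum_mem M p q hn' x.1

end Jacobian

/-! ### Algebraicity of the solutions of a grammar -/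

section Algebraicity

theorem derivation_adjoin_eq_zero {k K V : Type*} [Field k] [Field K] [Algebra k K] {s : Set K}
    [AddCommGroup V] [Module k V] [Module (IntermediateField.adjoin k s) V]
    (D : Derivation k (IntermediateField.adjoin k s) V)
    (h : ∀ x : IntermediateField.adjoin k s, (x : K) ∈ s → D x = 0) : D = 0 := by
  ext ⟨x, hx⟩
  rw [Derivation.zero_apply]
  induction hx using IntermediateField.adjoin_induction with
  | mem x hx => exact h ⟨x, _⟩ hx
  | algebraMap x => exact D.map_algebraMap x
  | add x y hx hy ihx ihy =>
    have := D.map_add ⟨x, hx⟩ ⟨y, hy⟩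
    rwa [ihx, ihy, add_zero] at this
  | inv x hx ihx =>
    have := D.leibniz_inv ⟨x, hx⟩
    rwa [ihx, smul_zero] at this
  | mul x y hx hy ihx ihy =>
    have := D.leibniz ⟨x, hx⟩ ⟨y, hy⟩
    rwa [ihx, ihy, smul_zero, smul_zero, add_zero] at this

theorem isAlgebraic_adjoin_of_D_eq_zero {k K : Type*} [Field k] [Field K] [Algebra k K]
    {s : Set K} (hs : s.Finite)
    (h : ∀ x : IntermediateField.adjoin k s, (x : K) ∈ s → KaehlerDifferential.D k _ x = 0) :
    Algebra.IsAlgebraic k (IntermediateField.adjoin k s) := by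
  have : Algebra.EssFiniteType k (IntermediateField.adjoin k s) :=
    (IntermediateField.essFiniteType_iff).2 (IntermediateField.fg_adjoin_of_finite hs)
  have : Algebra.FormallyUnramified k (IntermediateField.adjoin k s) := by
    refine ⟨?_⟩
    rw [← Submodule.subsingleton_iff (IntermediateField.adjoin k s),
      ← subsingleton_iff_bot_eq_top, ← KaehlerDifferential.span_range_derivation,
      derivation_adjoin_eq_zero _ h, eq_comm, Submodule.span_eq_bot]
    rintro _ ⟨x, rfl⟩
    rfl
  have := (Algebra.FormallyUnramified.iff_isSeparable k (IntermediateField.adjoin k s)).1 this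
  infer_instance

variable {T : Type*} {g : ContextFreeGrammar T}

/-- The values `S` of the symbols solve the system of polynomial equations, one for each
nonterminal, in which the rules of `g` are read as monomials. -/
def IsSolution {A : Type*} [CommSemiring A] (g : ContextFreeGrammar T) (S : Symbol T g.NT → A) :
    Prop :=
  ∀ X, S (.nonterminal X) = ∑ x : RightHandSide g X, (x.1.map S).prod

theorem IsSolution.map {A B : Type*} [CommSemiring A] [CommSemiring B] {S : Symbol T g.NT → A}
    (hS : IsSolution g S) (φ : A →+* B) : IsSolution g (φ ∘ S) := fun X => by
  simp only [Function.comp_apply, hS X, map_sum, map_list_prod, List.map_map]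

theorem IsSolution.of_map {A B : Type*} [CommSemiring A] [CommSemiring B] {S : Symbol T g.NT → A}
    {φ : A →+* B} (hφ : Function.Injective φ) (hS : IsSolution g (φ ∘ S)) : IsSolution g S :=
  fun X => hφ <| by
    simpa only [Function.comp_apply, map_sum, map_list_prod, List.map_map] using hS X

open scoped Classical in
/-- Every derivation of the field generated by a solution satisfies a homogeneous linear system
with matrix `1 - jacobian g S S`, so it vanishes. -/
theorem IsSolution.isAlgebraic_of_field {k K : Type*} [Field k] [Field K] [Algebra k K]
    {S : Symbol T g.NT → K} (hS : IsSolution g S)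
    (hterminal : ∀ t, S (.terminal t) ∈ Set.range (algebraMap k K))
    (hempty : ∀ X, IsEmpty (ParseForest g [.nonterminal X]) → S (.nonterminal X) = 0)
    (hdet : (1 - jacobian g S S).det ≠ 0) (x : Symbol T g.NT) : IsAlgebraic k (S x) := by
  let s : Set K := Set.range fun X : ProductiveNT g => S (.nonterminal X.1)
  let E := IntermediateField.adjoin k s
  have hmem (x : Symbol T g.NT) : S x ∈ E := by
    obtain t | X := x
    · obtain ⟨y, hy⟩ := hterminal t
      exact hy ▸ E.algebraMap_mem y
    obtain hX | hX := isEmpty_or_nonempty (ParseForest g [.nonterminal X])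
    · exact hempty X hX ▸ E.zero_mem
    · exact IntermediateField.subset_adjoin _ _ ⟨⟨X, hX⟩, rfl⟩
  let S' : Symbol T g.NT → E := fun x => ⟨S x, hmem x⟩
  have hS' : IsSolution g S' := IsSolution.of_map (algebraMap E K).injective hS
  have hdet' : (1 - jacobian g S' S').det ≠ 0 := fun h =>
    hdet <| (map_det_one_sub_jacobian (algebraMap E K) S' S').symm.trans (by rw [h, map_zero])
  have hD (x : Symbol T g.NT) : KaehlerDifferential.D k E (S' x) = 0 := by
    have := det_one_sub_jacobian_smul_mem (p := S') (q := S') ⊥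
      (n := KaehlerDifferential.D k E ∘ S') (fun X => ?_) (fun t => ?_) (fun X hX => ?_) x
    · exact (smul_eq_zero.1 this).resolve_left hdet'
    · simp only [Function.comp_apply, hS' X, map_sum, derivation_list_prod]
    · obtain ⟨y, hy⟩ := hterminal t
      have : S' (.terminal t) = algebraMap k E y := Subtype.ext hy.symm
      simp [this]
    · have : S' (.nonterminal X) = 0 := Subtype.ext (hempty X hX)
      simp [this]
  have : Algebra.IsAlgebraic k E := by
    refine isAlgebraic_adjoin_of_D_eq_zero (Set.finite_range _) ?_
    rintro x ⟨X, hX⟩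
    rw [← hD (.nonterminal X.1)]
    exact congrArg _ (Subtype.ext hX.symm)
  exact (Algebra.IsAlgebraic.isAlgebraic (R := k) (S' x)).algebraMap (A := K)

open scoped Classical in
theorem IsSolution.isAlgebraic {P R : Type*} [CommRing P] [IsDomain P] [CommRing R] [IsDomain R]
    [Algebra P R] [FaithfulSMul P R] {S : Symbol T g.NT → R} (hS : IsSolution g S)
    (hterminal : ∀ t, S (.terminal t) ∈ Set.range (algebraMap P R))
    (hempty : ∀ X, IsEmpty (ParseForest g [.nonterminal X]) → S (.nonterminal X) = 0)
    (hdet : (1 - jacobian g S S).det ≠ 0) (x : Symbol T g.NT) : IsAlgebraic P (S x) := by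
  let K := FractionRing R
  let := FractionRing.liftAlgebra P K
  have := FractionRing.isScalarTower_liftAlgebra P K
  have hK : Function.Injective (algebraMap R K) := IsFractionRing.injective R K
  rw [← isAlgebraic_algebraMap_iff hK, IsFractionRing.isAlgebraic_iff P (FractionRing P) K]
  refine (hS.map (algebraMap R K)).isAlgebraic_of_field (k := FractionRing P) (fun t => ?_)
    (fun X hX => ?_) ?_ x
  · obtain ⟨y, hy⟩ := hterminal t
    exact ⟨algebraMap P _ y, by
      rw [Function.comp_apply, ← hy, ← IsScalarTower.algebraMap_apply,
        ← IsScalarTower.algebraMap_apply]⟩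
  · rw [Function.comp_apply, hempty X hX, map_zero]
  · rw [← map_det_one_sub_jacobian]
    exact (map_ne_zero_iff _ hK).2 hdet

end Algebraicity

/-! ### Generating functions -/

open scoped PowerSeries

section DoubleSeries

variable (k : Type*) [CommRing k]

/-- Power series in the inner variable `x`, as power series in two variables `x` and `y`. -/
noncomputable def innerHom : k⟦X⟧ →ₐ[k] k⟦X⟧⟦X⟧ :=
  { (PowerSeries.C : k⟦X⟧ →+* k⟦X⟧⟦X⟧) with
    commutes' := fun _ => PowerSeries.algebraMap_apply.symm }

/-- Power series in the outer variable `y`, as power series in two variables `x` and `y`. -/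
noncomputable def outerHom : k⟦X⟧ →ₐ[k] k⟦X⟧⟦X⟧ :=
  PowerSeries.mapAlgHom (Algebra.ofId k k⟦X⟧)

variable {k}

theorem innerHom_apply (P : k⟦X⟧) : innerHom k P = PowerSeries.C P := rfl

theorem coeff_outerHom (Q : k⟦X⟧) (m : ℕ) :
    PowerSeries.coeff m (outerHom k Q) = PowerSeries.C (PowerSeries.coeff m Q) := rfl

theorem coeff_coeff_innerHom_mul (P : k⟦X⟧) (G : k⟦X⟧⟦X⟧) (n m : ℕ) :
    PowerSeries.coeff n (PowerSeries.coeff m (innerHom k P * G)) =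
      ∑ ij ∈ antidiagonal n,
        PowerSeries.coeff ij.1 P * PowerSeries.coeff ij.2 (PowerSeries.coeff m G) := by
  rw [innerHom_apply, PowerSeries.coeff_C_mul, PowerSeries.coeff_mul]

theorem coeff_coeff_mul_outerHom (G : k⟦X⟧⟦X⟧) (Q : k⟦X⟧) (n m : ℕ) :
    PowerSeries.coeff n (PowerSeries.coeff m (G * outerHom k Q)) =
      ∑ ij ∈ antidiagonal m,
        PowerSeries.coeff n (PowerSeries.coeff ij.1 G) * PowerSeries.coeff ij.2 Q := by
  rw [PowerSeries.coeff_mul, map_sum]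
  simp only [coeff_outerHom, PowerSeries.coeff_mul_C]

theorem coeff_coeff_innerHom_mul_outerHom (P Q : k⟦X⟧) (n m : ℕ) :
    PowerSeries.coeff n (PowerSeries.coeff m (innerHom k P * outerHom k Q)) =
      PowerSeries.coeff n P * PowerSeries.coeff m Q := by
  rw [innerHom_apply, PowerSeries.coeff_C_mul, coeff_outerHom, PowerSeries.coeff_mul_C]

theorem constantCoeff_constantCoeff_outerHom (Q : k⟦X⟧) :
    PowerSeries.constantCoeff (PowerSeries.constantCoeff (outerHom k Q)) =
      PowerSeries.constantCoeff Q := by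
  rw [← PowerSeries.coeff_zero_eq_constantCoeff_apply (outerHom k Q), coeff_outerHom,
    PowerSeries.constantCoeff_C, PowerSeries.coeff_zero_eq_constantCoeff_apply]

end DoubleSeries

section GeneratingFunctions

variable {T : Type*} {g : ContextFreeGrammar T} {k : Type*} [CommRing k]

/-- The generating function `∑ n, forestCount g s aⁿ * xⁿ`. -/
noncomputable def unarySeries (k : Type*) [CommRing k] (g : ContextFreeGrammar T) (a : T)
    (s : List (Symbol T g.NT)) : k⟦X⟧ :=
  PowerSeries.mk fun n => (forestCount g s (List.replicate n a) : k)

/-- The generating function `∑ n m, forestCount g s (aⁿ bᵐ) * xⁿ * yᵐ`; the inner variable is `x`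
and the outer one is `y`. -/
noncomputable def binarySeries (k : Type*) [CommRing k] (g : ContextFreeGrammar T) (a b : T)
    (s : List (Symbol T g.NT)) : k⟦X⟧⟦X⟧ :=
  PowerSeries.mk fun m => PowerSeries.mk fun n =>
    (forestCount g s (List.replicate n a ++ List.replicate m b) : k)

/-- The part of `binarySeries` of positive degree in the outer variable. -/
noncomputable def positiveSeries (k : Type*) [CommRing k] (g : ContextFreeGrammar T) (a b : T)
    (s : List (Symbol T g.NT)) : k⟦X⟧⟦X⟧ :=
  binarySeries k g a b s - innerHom k (unarySeries k g a s)

theorem nullable_of_constantCoeff_unarySeries_ne_zero {a : T} {s : List (Symbol T g.NT)}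
    (h : PowerSeries.constantCoeff (unarySeries k g a s) ≠ 0) : Nullable g s := by
  rw [← PowerSeries.coeff_zero_eq_constantCoeff_apply, unarySeries, PowerSeries.coeff_mk,
    List.replicate_zero] at h
  exact nullable_of_forestCount_ne_zero fun h0 => h (by rw [h0, Nat.cast_zero])

theorem unarySeries_nil (a : T) : unarySeries k g a [] = 1 := by
  classical
  ext n
  simp [unarySeries, forestCount_nil, PowerSeries.coeff_one]

theorem unarySeries_terminal [DecidableEq T] (a t : T) :
    unarySeries k g a [.terminal t] = if t = a then PowerSeries.X else 0 := by
  ext n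
  rw [unarySeries, PowerSeries.coeff_mk, forestCount_terminal]
  by_cases h : t = a <;>
    simp [h, PowerSeries.coeff_X, eq_comm (a := List.replicate n a), List.eq_replicate_iff,
      eq_comm (a := 1)]

theorem unarySeries_of_isEmpty (a : T) {A : g.NT} (hA : IsEmpty (ParseForest g [.nonterminal A])) :
    unarySeries k g a [.nonterminal A] = 0 := by
  ext n
  simp [unarySeries, forestCount_of_isEmpty hA]

theorem binarySeries_nil (a b : T) : binarySeries k g a b [] = 1 := by
  classical
  ext m n
  by_cases hm : m = 0 <;>
    simp [binarySeries, forestCount_nil, PowerSeries.coeff_one, hm]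

theorem binarySeries_terminal (a b t : T) :
    binarySeries k g a b [.terminal t] =
      innerHom k (unarySeries k g a [.terminal t]) +
        outerHom k (unarySeries k g b [.terminal t]) := by
  classical
  ext m n
  simp only [binarySeries, innerHom_apply, coeff_outerHom, map_add, PowerSeries.coeff_mk,
    unarySeries, PowerSeries.coeff_C, forestCount_terminal]
  obtain _ | m := m <;> obtain _ | n := n
  · simp
  · simp
  · simp
  · have hword : List.replicate (n + 1) a ++ List.replicate (m + 1) b ≠ [t] := fun h => by
      have := congrArg List.length h
      simp only [List.length_append, List.length_replicate, List.length_singleton] at this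
      omega
    simp [hword]

theorem positiveSeries_terminal (a b t : T) :
    positiveSeries k g a b [.terminal t] = outerHom k (unarySeries k g b [.terminal t]) := by
  rw [positiveSeries, binarySeries_terminal, add_sub_cancel_left]

theorem positiveSeries_of_isEmpty (a b : T) {A : g.NT}
    (hA : IsEmpty (ParseForest g [.nonterminal A])) :
    positiveSeries k g a b [.nonterminal A] = 0 := by
  rw [positiveSeries, unarySeries_of_isEmpty a hA, map_zero, sub_zero]
  ext m n
  simp [binarySeries, forestCount_of_isEmpty hA]

variable [FinitelyAmbiguous g]

theorem unarySeries_cons (a : T) (X : Symbol T g.NT) (s : List (Symbol T g.NT)) :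
    unarySeries k g a (X :: s) = unarySeries k g a [X] * unarySeries k g a s := by
  ext n
  simp only [unarySeries, PowerSeries.coeff_mul, PowerSeries.coeff_mk]
  rw [forestCount_cons_replicate]
  push_cast
  rfl

theorem unarySeries_eq_prod (a : T) (s : List (Symbol T g.NT)) :
    unarySeries k g a s = (s.map fun X => unarySeries k g a [X]).prod := by
  induction s with
  | nil => exact unarySeries_nil a
  | cons X s ih => rw [unarySeries_cons, ih, List.map_cons, List.prod_cons]

theorem unarySeries_nonterminal (a : T) (A : g.NT) :
    unarySeries k g a [.nonterminal A] = ∑ x : RightHandSide g A, unarySeries k g a x.1 := by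
  ext n
  simp [unarySeries, forestCount_nonterminal]

theorem isSolution_unarySeries (a : T) : IsSolution g fun X => unarySeries k g a [X] := fun A => by
  simp only [← unarySeries_eq_prod, unarySeries_nonterminal]

theorem binarySeries_cons (a b : T) (X : Symbol T g.NT) (s : List (Symbol T g.NT)) :
    binarySeries k g a b (X :: s) +
        innerHom k (unarySeries k g a [X]) * outerHom k (unarySeries k g b s) =
      innerHom k (unarySeries k g a [X]) * binarySeries k g a b s +
        binarySeries k g a b [X] * outerHom k (unarySeries k g b s) := by
  ext m n
  have := congrArg (Nat.cast (R := k))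
    (forestCount_cons_replicate_append_replicate X s a b n m)
  push_cast at this
  rw [map_add, map_add, map_add, map_add, coeff_coeff_innerHom_mul_outerHom,
    coeff_coeff_innerHom_mul, coeff_coeff_mul_outerHom]
  simpa only [unarySeries, binarySeries, PowerSeries.coeff_mk] using this

/-- Subtracting the terms of degree `0` in the outer variable turns the twisted product rule of
`binarySeries_cons` into a derivation. -/
theorem positiveSeries_eq_leibnizSum (a b : T) (s : List (Symbol T g.NT)) :
    positiveSeries k g a b s = leibnizSum (fun X => innerHom k (unarySeries k g a [X]))
      (fun X => outerHom k (unarySeries k g b [X])) s (fun X => positiveSeries k g a b [X]) := by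
  induction s with
  | nil => rw [positiveSeries, binarySeries_nil, unarySeries_nil, map_one, sub_self, leibnizSum_nil]
  | cons X s ih =>
    have hq : (s.map fun X => outerHom k (unarySeries k g b [X])).prod =
        outerHom k (unarySeries k g b s) := by
      rw [unarySeries_eq_prod b s, map_list_prod, List.map_map]
      rfl
    rw [leibnizSum_cons, ← ih, hq, smul_eq_mul, smul_eq_mul, positiveSeries, positiveSeries,
      positiveSeries, unarySeries_cons, map_mul]
    linear_combination binarySeries_cons (k := k) a b X s

theorem positiveSeries_nonterminal (a b : T) (A : g.NT) :
    positiveSeries k g a b [.nonterminal A] =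
      ∑ x : RightHandSide g A, leibnizSum (fun X => innerHom k (unarySeries k g a [X]))
        (fun X => outerHom k (unarySeries k g b [X])) x.1
        (fun X => positiveSeries k g a b [X]) := by
  have hbinary : binarySeries k g a b [.nonterminal A] =
      ∑ x : RightHandSide g A, binarySeries k g a b x.1 := by
    ext m n
    simp [binarySeries, forestCount_nonterminal]
  rw [positiveSeries, hbinary, unarySeries_nonterminal, map_sum, ← Finset.sum_sub_distrib]
  exact Finset.sum_congr rfl fun x _ => positiveSeries_eq_leibnizSum a b x.1

end GeneratingFunctions

/-! ### Separable multiples of the generating function -/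

section Separability

open scoped Polynomial

instance {R A : Type*} [CommSemiring R] [CommSemiring A] [Algebra R A] [FaithfulSMul R A] :
    FaithfulSMul R[X] A⟦X⟧ := by
  rw [faithfulSMul_iff_algebraMap_injective]
  intro p q h
  ext n
  apply FaithfulSMul.algebraMap_injective R A
  simpa [PowerSeries.algebraMap_apply'] using congrArg (PowerSeries.coeff n) h

/-- The finite sums of products `P(x) * Q(y)` of power series in one variable each; among them are
the polynomials in `x` and `y`. -/
noncomputable def separableSeries (k : Type*) [CommRing k] : Subalgebra k[X][X] k⟦X⟧⟦X⟧ where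
  toSubsemiring := ((innerHom k).range ⊔ (outerHom k).range).toSubsemiring
  algebraMap_mem' r := by
    change _ ∈ (innerHom k).range ⊔ (outerHom k).range
    have hX : (PowerSeries.X : k⟦X⟧⟦X⟧) ∈ (innerHom k).range ⊔ (outerHom k).range :=
      (le_sup_right : (outerHom k).range ≤ _) ⟨PowerSeries.X, PowerSeries.map_X _⟩
    induction r using Polynomial.induction_on with
    | C p =>
      refine (le_sup_left : (innerHom k).range ≤ _) ⟨p, ?_⟩
      simp [PowerSeries.algebraMap_apply', innerHom_apply]
    | add p q hp hq => rw [map_add]; exact add_mem hp hq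
    | monomial n p h =>
      rw [pow_succ, ← mul_assoc, map_mul]
      convert mul_mem h hX
      simp [PowerSeries.algebraMap_apply']

section CommRing

variable {k : Type*} [CommRing k]

theorem mem_separableSeries {G : k⟦X⟧⟦X⟧} :
    G ∈ separableSeries k ↔ G ∈ (innerHom k).range ⊔ (outerHom k).range := Iff.rfl

theorem innerHom_mem_separableSeries (P : k⟦X⟧) : innerHom k P ∈ separableSeries k :=
  (le_sup_left : (innerHom k).range ≤ _) ⟨P, rfl⟩

theorem outerHom_mem_separableSeries (Q : k⟦X⟧) : outerHom k Q ∈ separableSeries k :=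
  (le_sup_right : (outerHom k).range ≤ _) ⟨Q, rfl⟩

theorem isAlgebraic_innerHom {P : k⟦X⟧} (h : IsAlgebraic k[X] P) :
    IsAlgebraic k[X][X] (innerHom k P) :=
  h.ringHom_of_comp_eq (Polynomial.C : k[X] →+* k[X][X]) (innerHom k) Polynomial.C_injective <| by
    ext <;> simp [PowerSeries.algebraMap_apply', innerHom_apply]

theorem isAlgebraic_outerHom {Q : k⟦X⟧} (h : IsAlgebraic k[X] Q) :
    IsAlgebraic k[X][X] (outerHom k Q) :=
  h.ringHom_of_comp_eq (Polynomial.mapRingHom Polynomial.C : k[X] →+* k[X][X]) (outerHom k)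
    (Polynomial.map_injective _ Polynomial.C_injective) <| by
    ext <;> simp [PowerSeries.algebraMap_apply', outerHom, PowerSeries.mapAlgHom_apply]

end CommRing

theorem leibnizSum_algebraMap_comp {σ A B V : Type*} [CommRing A] [CommRing B] [Algebra A B]
    [AddCommGroup V] [Module A V] [Module B V] [IsScalarTower A B V] (p q : σ → A) (s : List σ)
    (n : σ → V) :
    leibnizSum (algebraMap A B ∘ p) (algebraMap A B ∘ q) s n = leibnizSum p q s n := by
  induction s with
  | nil => rfl
  | cons x s ih =>
    rw [leibnizSum_cons, leibnizSum_cons, ih, ← List.map_map, ← map_list_prod, algebraMap_smul,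
      Function.comp_apply, algebraMap_smul]

theorem exists_algebraMap_mul_mem_of_isAlgebraic {P R : Type*} [CommRing P] [CommRing R]
    [IsDomain R] [Algebra P R] {B : Subalgebra P R} {d : R} (hdB : d ∈ B) (hd : IsAlgebraic P d)
    (hd0 : d ≠ 0) {y : R} (h : d * y ∈ B) : ∃ r : P, r ≠ 0 ∧ algebraMap P R r * y ∈ B := by
  have hd' : IsAlgebraic P (⟨d, hdB⟩ : B) :=
    (isAlgebraic_algHom_iff B.val Subtype.val_injective).1 hd
  obtain ⟨r, hr, e, he⟩ := hd'.exists_nonzero_dvd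
    (mem_nonZeroDivisors_of_ne_zero fun h => hd0 (congrArg Subtype.val h))
  refine ⟨r, hr, ?_⟩
  have hrd : algebraMap P R r = d * e := congrArg Subtype.val he
  rw [hrd, mul_right_comm, mul_comm]
  exact B.mul_mem e.2 h

variable {T : Type*} {g : ContextFreeGrammar T} [FinitelyAmbiguous g]
  {k : Type*} [CommRing k] [IsDomain k]

open scoped Classical in
theorem det_one_sub_jacobian_unarySeries_ne_zero (a : T) :
    (1 - jacobian g (fun x => unarySeries k g a [x]) fun x => unarySeries k g a [x]).det ≠ 0 := by
  intro h
  have hmap := map_det_one_sub_jacobian (PowerSeries.constantCoeff (R := k))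
    (fun x => unarySeries k g a [x]) (fun x => unarySeries k g a [x])
  rw [h, map_zero] at hmap
  exact det_one_sub_jacobian_ne_zero (A := k)
    (fun x => nullable_of_constantCoeff_unarySeries_ne_zero)
    (fun x => nullable_of_constantCoeff_unarySeries_ne_zero) hmap.symm

theorem isAlgebraic_unarySeries (a : T) (x : Symbol T g.NT) :
    IsAlgebraic k[X] (unarySeries k g a [x]) := by
  classical
  have hterminal (t : T) : unarySeries k g a [.terminal t] ∈ Set.range (algebraMap k[X] k⟦X⟧) := by
    refine ⟨if t = a then Polynomial.X else 0, ?_⟩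
    rw [unarySeries_terminal]
    split_ifs <;> simp [PowerSeries.algebraMap_apply']
  have hS := isSolution_unarySeries (k := k) (g := g) a
  exact hS.isAlgebraic hterminal (fun X hX => unarySeries_of_isEmpty a hX)
    (det_one_sub_jacobian_unarySeries_ne_zero a) x

open scoped Classical in
theorem det_one_sub_jacobian_innerHom_outerHom_ne_zero (a b : T) :
    (1 - jacobian g (fun x => innerHom k (unarySeries k g a [x]))
      fun x => outerHom k (unarySeries k g b [x])).det ≠ 0 := by
  intro h
  have hmap := map_det_one_sub_jacobian
    (PowerSeries.constantCoeff.comp PowerSeries.constantCoeff : k⟦X⟧⟦X⟧ →+* k)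
    (fun x => innerHom k (unarySeries k g a [x])) (fun x => outerHom k (unarySeries k g b [x]))
  rw [h, map_zero] at hmap
  refine det_one_sub_jacobian_ne_zero (A := k)
    (fun x hx => nullable_of_constantCoeff_unarySeries_ne_zero (k := k) (a := a) ?_)
    (fun x hx => nullable_of_constantCoeff_unarySeries_ne_zero (k := k) (a := b) ?_) hmap.symm
  · simpa [innerHom_apply] using hx
  · rwa [← constantCoeff_constantCoeff_outerHom]

open scoped Classical in
theorem exists_mul_binarySeries_mem_separableSeries (a b : T) (x : Symbol T g.NT) :
    ∃ r : k[X][X], r ≠ 0 ∧ algebraMap _ k⟦X⟧⟦X⟧ r * binarySeries k g a b [x] ∈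
      separableSeries k := by
  let B : Subalgebra k[X][X] k⟦X⟧⟦X⟧ :=
    separableSeries k ⊓ Subalgebra.algebraicClosure k[X][X] k⟦X⟧⟦X⟧
  let p : Symbol T g.NT → B := fun x => ⟨innerHom k (unarySeries k g a [x]),
    innerHom_mem_separableSeries _, isAlgebraic_innerHom (isAlgebraic_unarySeries a x)⟩
  let q : Symbol T g.NT → B := fun x => ⟨outerHom k (unarySeries k g b [x]),
    outerHom_mem_separableSeries _, isAlgebraic_outerHom (isAlgebraic_unarySeries b x)⟩
  let d : B := (1 - jacobian g p q).det
  have hd0 : algebraMap B k⟦X⟧⟦X⟧ d ≠ 0 := by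
    rw [map_det_one_sub_jacobian (algebraMap B k⟦X⟧⟦X⟧) p q]
    exact det_one_sub_jacobian_innerHom_outerHom_ne_zero (k := k) (g := g) a b
  have hpositive : d • positiveSeries k g a b [x] ∈ (1 : Submodule B k⟦X⟧⟦X⟧) := by
    refine det_one_sub_jacobian_smul_mem (p := p) (q := q)
      (n := fun x => positiveSeries k g a b [x]) _ (fun X => ?_) (fun t => ?_) (fun X hX => ?_) x
    · rw [positiveSeries_nonterminal]
      exact Finset.sum_congr rfl fun x _ => leibnizSum_algebraMap_comp p q x.1 _
    · exact Submodule.mem_one.2 ⟨q (.terminal t), (positiveSeries_terminal a b t).symm⟩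
    · rw [positiveSeries_of_isEmpty a b hX]
      exact Submodule.zero_mem _
  obtain ⟨y, hy⟩ := Submodule.mem_one.1 hpositive
  have hmem : (d : k⟦X⟧⟦X⟧) * positiveSeries k g a b [x] ∈ B := Set.mem_of_eq_of_mem hy.symm y.2
  obtain ⟨r, hr, hmem⟩ := exists_algebraMap_mul_mem_of_isAlgebraic d.2 d.2.2 hd0 hmem
  refine ⟨r, hr, ?_⟩
  rw [← sub_add_cancel (binarySeries k g a b [x]) (innerHom k (unarySeries k g a [x])), mul_add]
  exact add_mem hmem.1 (mul_mem (algebraMap_mem _ r) (innerHom_mem_separableSeries _))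

end Separability

/-! ### Rationality -/

section Rationality

open Filter
open scoped Polynomial

/-- The coefficients tend to zero in the `I`-adic topology. For `I = (x)` in `k[x]` this says that
each power of `x` occurs in only finitely many coefficients. -/
def IsAdicallyRestricted {A : Type*} [CommRing A] (I : Ideal A) (G : A⟦X⟧) : Prop :=
  ∀ n, ∀ᶠ m in atTop, PowerSeries.coeff m G ∈ I ^ n

theorem IsAdicallyRestricted.coe_mul {A : Type*} [CommRing A] {I : Ideal A} {G : A⟦X⟧}
    (hG : IsAdicallyRestricted I G) (s : A[X]) : IsAdicallyRestricted I ((s : A⟦X⟧) * G) := by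
  intro n
  obtain ⟨M, hM⟩ := eventually_atTop.1 (hG n)
  filter_upwards [eventually_ge_atTop (s.natDegree + M)] with m hm
  rw [PowerSeries.coeff_mul]
  refine Ideal.sum_mem _ fun ij hij => ?_
  have hij : ij.1 + ij.2 = m := Finset.HasAntidiagonal.mem_antidiagonal.1 hij
  rw [Polynomial.coeff_coe]
  obtain h | h := lt_or_ge s.natDegree ij.1
  · rw [Polynomial.coeff_eq_zero_of_natDegree_lt h, zero_mul]
    exact Ideal.zero_mem _
  · exact Ideal.mul_mem_left _ _ (hM _ (by omega))

theorem isAdicallyRestricted_span_X_iff {k : Type*} [CommRing k] {H : k[X]⟦X⟧} :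
    IsAdicallyRestricted (Ideal.span {Polynomial.X}) H ↔
      ∀ n, ∀ᶠ m in atTop, (PowerSeries.coeff m H).coeff n = 0 := by
  simp only [IsAdicallyRestricted, Ideal.span_singleton_pow, Ideal.mem_span_singleton,
    Polynomial.X_pow_dvd_iff]
  refine ⟨fun h n => (h (n + 1)).mono fun m hm => hm n n.lt_succ_self, fun h n => ?_⟩
  simpa using (eventually_all_finset (Finset.range n)).2 fun i _ => h i

theorem exists_fg_forall_coeff_mem_of_mem_separableSeries {k : Type*} [CommRing k]
    {G : k⟦X⟧⟦X⟧} (hG : G ∈ separableSeries k) :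
    ∃ W : Submodule k (ℕ → k), W.FG ∧
      ∀ n, (fun m => PowerSeries.coeff n (PowerSeries.coeff m G)) ∈ W := by
  rw [mem_separableSeries, ← Subalgebra.mem_toSubmodule, ← Subalgebra.mul_toSubmodule] at hG
  induction hG using Submodule.mul_induction_on' with
  | mem_mul_mem P hP Q hQ =>
    obtain ⟨P, rfl⟩ := hP
    obtain ⟨Q, rfl⟩ := hQ
    refine ⟨Submodule.span k {fun m => PowerSeries.coeff m Q}, Submodule.fg_span_singleton _,
      fun n => Submodule.mem_span_singleton.2 ⟨PowerSeries.coeff n P, ?_⟩⟩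
    exact funext fun m => (coeff_coeff_innerHom_mul_outerHom P Q n m).symm
  | add G _ G' _ ih ih' =>
    obtain ⟨W, hW, h⟩ := ih
    obtain ⟨W', hW', h'⟩ := ih'
    refine ⟨W ⊔ W', hW.sup hW', fun n => ?_⟩
    simp only [map_add]
    exact Submodule.add_mem_sup (h n) (h' n)

theorem exists_coe_eq_of_mem_separableSeries {k : Type*} [CommRing k] [IsNoetherianRing k]
    {H : k[X]⟦X⟧} (hH : IsAdicallyRestricted (Ideal.span {Polynomial.X}) H)
    (h : PowerSeries.map (algebraMap k[X] k⟦X⟧) H ∈ separableSeries k) :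
    ∃ q : k[X][X], (q : k[X]⟦X⟧) = H := by
  rw [isAdicallyRestricted_span_X_iff] at hH
  let row (n m : ℕ) : k := (PowerSeries.coeff m H).coeff n
  obtain ⟨W, hW, hrow⟩ := exists_fg_forall_coeff_mem_of_mem_separableSeries h
  have hrows : (Submodule.span k (Set.range row)).FG := by
    refine hW.of_le (Submodule.span_le.2 ?_)
    rintro _ ⟨n, rfl⟩
    simpa [PowerSeries.algebraMap_apply'] using hrow n
  obtain ⟨t, ht, hspan⟩ := (Submodule.fg_span_iff_fg_span_finset_subset _).1 hrows
  have hvanish : ∀ᶠ m in atTop, ∀ v ∈ t, v m = 0 := by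
    refine (eventually_all_finset t).2 fun v hv => ?_
    obtain ⟨n, rfl⟩ := ht hv
    exact hH n
  obtain ⟨D, hD⟩ := eventually_atTop.1 hvanish
  refine ⟨PowerSeries.trunc D H, ?_⟩
  ext m n
  rw [Polynomial.coeff_coe, PowerSeries.coeff_trunc]
  split_ifs with hm
  · rfl
  · have hker : Submodule.span k (Set.range row) ≤ LinearMap.ker (LinearMap.proj m) :=
      hspan ▸ Submodule.span_le.2 fun v hv => hD m (not_lt.1 hm) v hv
    exact (hker (Submodule.subset_span ⟨n, rfl⟩)).symm

/-- The common powers of `π` must be cancelled first, since otherwise `s` might be mapped to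
zero. -/
theorem exists_mul_map_eq {A B : Type*} [CommRing A] [IsDomain A] [WfDvdMonoid A] [CommRing B]
    (φ : A →+* B) {π : A} (hπ : Prime π) (hφ : ∀ x, φ x = 0 ↔ π ∣ x) {G : A⟦X⟧} {s q : A[X]}
    (hs : s ≠ 0) (h : (s : A⟦X⟧) * G = q) :
    ∃ s' q' : B[X], s' ≠ 0 ∧ (s' : B⟦X⟧) * PowerSeries.map φ G = q' := by
  obtain ⟨e, s₁, hs₁, rfl⟩ :=
    WfDvdMonoid.max_power_factor hs (Polynomial.prime_C_iff.2 hπ).irreducible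
  have hcoe : ((Polynomial.C π ^ e : A[X]) : A⟦X⟧) = PowerSeries.C (π ^ e) := by
    rw [← Polynomial.C_pow, Polynomial.coe_C]
  rw [Polynomial.coe_mul, hcoe, mul_assoc] at h
  obtain ⟨q₁, rfl⟩ : Polynomial.C (π ^ e) ∣ q := by
    refine (Polynomial.C_dvd_iff_dvd_coeff _ _).2 fun i => ?_
    rw [← Polynomial.coeff_coe, ← h, PowerSeries.coeff_C_mul]
    exact dvd_mul_right _ _
  have h₁ : (s₁ : A⟦X⟧) * G = q₁ := by
    have hpow : PowerSeries.C (π ^ e) ≠ 0 :=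
      (map_ne_zero_iff _ PowerSeries.C_injective).2 (pow_ne_zero e hπ.ne_zero)
    exact mul_left_cancel₀ hpow (by rw [h, Polynomial.coe_mul, Polynomial.coe_C])
  refine ⟨s₁.map φ, q₁.map φ, fun h0 => hs₁ ?_, ?_⟩
  · refine (Polynomial.C_dvd_iff_dvd_coeff _ _).2 fun i => (hφ _).1 ?_
    rw [← Polynomial.coeff_map, h0, Polynomial.coeff_zero]
  · rw [Polynomial.polynomial_map_coe, Polynomial.polynomial_map_coe, ← map_mul, h₁]

theorem exists_dvd_X_pow_add_sub_X_pow {F : Type*} [Field F] [Finite F] {s : F[X]} (hs : s ≠ 0) :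
    ∃ i d, 0 < d ∧ s ∣ Polynomial.X ^ (i + d) - Polynomial.X ^ i := by
  have : Module.Finite F (AdjoinRoot s) := (AdjoinRoot.powerBasis hs).finite
  have : Finite (AdjoinRoot s) := Module.finite_of_finite F
  obtain ⟨i, j, hij, h⟩ := Set.finite_univ.exists_lt_map_eq_of_forall_mem
    fun n : ℕ => Set.mem_univ (AdjoinRoot.mk s (Polynomial.X ^ n))
  obtain ⟨d, hd, rfl⟩ := Nat.exists_eq_add_of_lt hij
  exact ⟨i, d + 1, d.succ_pos, AdjoinRoot.mk_eq_mk.1 h.symm⟩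

theorem eventually_coeff_add_eq_of_mul_eq {F : Type*} [Field F] [Finite F] {φ : F⟦X⟧}
    {s q : F[X]} (hs : s ≠ 0) (h : (s : F⟦X⟧) * φ = q) :
    ∃ d > 0, ∀ᶠ m in atTop, PowerSeries.coeff (m + d) φ = PowerSeries.coeff m φ := by
  obtain ⟨i, d, hd, u, hu⟩ := exists_dvd_X_pow_add_sub_X_pow hs
  have hmul : PowerSeries.X ^ i * φ - PowerSeries.X ^ (i + d) * φ = ((-u * q : F[X]) : F⟦X⟧) := by
    have := congrArg (fun p : F[X] => (p : F⟦X⟧) * φ) hu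
    simp only [Polynomial.coe_sub, Polynomial.coe_mul, Polynomial.coe_pow, Polynomial.coe_X,
      Polynomial.coe_neg] at this ⊢
    linear_combination -this - (u : F⟦X⟧) * h
  refine ⟨d, hd, ?_⟩
  filter_upwards [eventually_gt_atTop (-u * q).natDegree] with m hm
  have hcoeff := congrArg (PowerSeries.coeff (m + (i + d))) hmul
  rwa [Polynomial.coeff_coe, Polynomial.coeff_eq_zero_of_natDegree_lt (by omega), map_sub,
    PowerSeries.coeff_X_pow_mul, show m + (i + d) = m + d + i by omega,
    PowerSeries.coeff_X_pow_mul, sub_eq_zero] at hcoeff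

theorem IsAdicallyRestricted.eventually_coeff_add_map_evalRingHom_eq {k : Type*} [Field k]
    [Finite k] {H : k[X]⟦X⟧} (hH : IsAdicallyRestricted (Ideal.span {Polynomial.X}) H)
    {r : k[X][X]} (hr : r ≠ 0)
    (hmem : algebraMap _ k⟦X⟧⟦X⟧ r * PowerSeries.map (algebraMap k[X] k⟦X⟧) H ∈ separableSeries k)
    (c : k) :
    ∃ d > 0, ∀ᶠ m in atTop,
      PowerSeries.coeff (m + d) (PowerSeries.map (Polynomial.evalRingHom c) H) =
        PowerSeries.coeff m (PowerSeries.map (Polynomial.evalRingHom c) H) := by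
  rw [PowerSeries.algebraMap_apply', ← map_mul] at hmem
  obtain ⟨q, hq⟩ := exists_coe_eq_of_mem_separableSeries (hH.coe_mul r) hmem
  obtain ⟨s', q', hs', h⟩ := exists_mul_map_eq (Polynomial.evalRingHom c)
    (Polynomial.prime_X_sub_C c) (fun p => Polynomial.dvd_iff_isRoot.symm) hr hq.symm
  exact eventually_coeff_add_eq_of_mul_eq hs' h

theorem isFiniteUnion_of_eventually_add_mem_iff {S : Set ℕ} {d : ℕ} (hd : 0 < d)
    (h : ∀ᶠ m in atTop, m + d ∈ S ↔ m ∈ S) : IsFiniteUnionOfArithmeticProgressions S := by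
  classical
  obtain ⟨M, hM⟩ := eventually_atTop.1 h
  have hmul (m : ℕ) (hm : M ≤ m) (k : ℕ) : m + k * d ∈ S ↔ m ∈ S := by
    induction k with
    | zero => simp
    | succ k ih => rw [← ih, ← hM (m + k * d) (by omega)]; ring_nf
  refine ⟨((Finset.range M).filter (· ∈ S)).image (fun c => (c, 0)) ∪
    ((Finset.Ico M (M + d)).filter (· ∈ S)).image (fun c => (c, d)), Set.ext fun m => ?_⟩
  simp only [Set.mem_iUnion, exists_prop, Finset.mem_union, Finset.mem_image, Finset.mem_filter,
    Finset.mem_range, Finset.mem_Ico, arithmeticProgression, Set.mem_ofPred_eq]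
  constructor
  · intro hm
    obtain hmM | hmM := lt_or_ge m M
    · exact ⟨(m, 0), Or.inl ⟨m, ⟨hmM, hm⟩, rfl⟩, 0, by simp⟩
    · have hdiv : m = M + (m - M) % d + (m - M) / d * d := by
        have := Nat.mod_add_div' (m - M) d
        omega
      have hlt := Nat.mod_lt (m - M) hd
      have hc : M + (m - M) % d ∈ S := (hmul _ (by omega) ((m - M) / d)).1 (hdiv ▸ hm)
      exact ⟨(_, d), Or.inr ⟨_, ⟨⟨by omega, by omega⟩, hc⟩, rfl⟩, _, hdiv⟩
  · rintro ⟨_, ⟨c, ⟨_, hc⟩, rfl⟩ | ⟨c, ⟨⟨hcM, _⟩, hc⟩, rfl⟩, k, rfl⟩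
    · simpa using hc
    · exact (hmul c hcM k).2 hc

end Rationality

section Parity

open Filter
open scoped Polynomial

variable {T : Type*}

open scoped Classical in
theorem forestCount_cast_zmod_two (G : GF2Grammar T) (w : List T) :
    (forestCount G.ordinary [.nonterminal G.ordinary.initial] w : ZMod 2) =
      if w ∈ G.language then 1 else 0 := by
  split_ifs with h
  · exact ZMod.natCast_eq_one_iff_odd.2 h
  · exact ZMod.natCast_eq_zero_iff_even.2 (Nat.not_odd_iff_even.1 h)

theorem isFiniteUnion_setOf_odd_ncard (G : GF2Grammar T) (a b : T)
    (hrow : ∀ n, {m | List.replicate n a ++ List.replicate m b ∈ G.language}.Finite)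
    (hcol : ∀ m, {n | List.replicate n a ++ List.replicate m b ∈ G.language}.Finite) :
    IsFiniteUnionOfArithmeticProgressions
      {m | Odd {n | List.replicate n a ++ List.replicate m b ∈ G.language}.ncard} := by
  classical
  let H : (ZMod 2)[X]⟦X⟧ :=
    PowerSeries.mk fun m => ∑ n ∈ (hcol m).toFinset, Polynomial.X ^ n
  have hcoeff (n m : ℕ) : (PowerSeries.coeff m H).coeff n =
      if List.replicate n a ++ List.replicate m b ∈ G.language then 1 else 0 := by
    simp [H, Polynomial.coeff_X_pow]
  have hbinary : PowerSeries.map (algebraMap (ZMod 2)[X] (ZMod 2)⟦X⟧) H =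
      binarySeries (ZMod 2) G.ordinary a b [.nonterminal G.ordinary.initial] := by
    ext m n
    simp [binarySeries, forestCount_cast_zmod_two, PowerSeries.algebraMap_apply', hcoeff]
  have hH : IsAdicallyRestricted (Ideal.span {Polynomial.X}) H :=
    isAdicallyRestricted_span_X_iff.2 fun n => by
      filter_upwards [Nat.cofinite_eq_atTop ▸ (hrow n).eventually_cofinite_notMem] with m hm
      exact (hcoeff n m).trans (if_neg hm)
  obtain ⟨r, hr, hmem⟩ := exists_mul_binarySeries_mem_separableSeries (k := ZMod 2) a b
    (.nonterminal G.ordinary.initial)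
  rw [← hbinary] at hmem
  obtain ⟨d, hd, hperiod⟩ := hH.eventually_coeff_add_map_evalRingHom_eq hr hmem 1
  have heval (m : ℕ) : PowerSeries.coeff m (PowerSeries.map (Polynomial.evalRingHom 1) H) =
      {n | List.replicate n a ++ List.replicate m b ∈ G.language}.ncard := by
    rw [Set.ncard_eq_toFinset_card _ (hcol m)]
    simp [H]
  refine isFiniteUnion_of_eventually_add_mem_iff hd (hperiod.mono fun m hm => ?_)
  rw [heval, heval] at hm
  rw [Set.mem_ofPred_eq, Set.mem_ofPred_eq, ← ZMod.natCast_eq_one_iff_odd, hm,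
    ZMod.natCast_eq_one_iff_odd]

end Parity

theorem theorem3p4_general {T : Type*} {a b : T} (hab : a ≠ b) {I : Set ℕ} {f : ℕ → ℕ}
    (hf : Set.InjOn f I)
    (hL : IsDescribedByGF2Grammar
      ({w | ∃ n ∈ I, w = List.replicate n a ++ List.replicate (f n) b} : Language T)) :
    IsFiniteUnionOfArithmeticProgressions (f '' I) := by
  obtain ⟨G, hG⟩ := hL
  have hmem (n m : ℕ) :
      List.replicate n a ++ List.replicate m b ∈ G.language ↔ n ∈ I ∧ f n = m := by
    rw [hG]
    constructor
    · rintro ⟨n', hn', h⟩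
      obtain ⟨rfl, rfl⟩ := (replicate_append_replicate_inj hab).1 h
      exact ⟨hn', rfl⟩
    · rintro ⟨hn, rfl⟩
      exact ⟨n, hn, rfl⟩
  have hcol (m : ℕ) : {n | n ∈ I ∧ f n = m}.Subsingleton := fun n hn n' hn' =>
    hf hn.1 hn'.1 (hn.2.trans hn'.2.symm)
  have hodd (m : ℕ) : Odd {n | n ∈ I ∧ f n = m}.ncard ↔ m ∈ f '' I := by
    obtain h | ⟨n, h⟩ := (hcol m).eq_empty_or_singleton
    · rw [h]
      simpa using Set.eq_empty_iff_forall_notMem.1 h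
    · have hn : n ∈ I ∧ f n = m := h.symm.subset rfl
      simpa [h] using ⟨n, hn⟩
  have hG' := isFiniteUnion_setOf_odd_ncard G a b
  simp only [hmem, hodd] at hG'
  exact hG' (fun n => (Set.finite_singleton (f n)).subset fun m hm => hm.2.symm)
    fun m => (hcol m).finite

/-- Here `n₀ = 0` and `n₀ = 1` are the two usual conventions for the first natural number. -/
theorem theorem3p4 {T : Type*} [Finite T] (a b : T) (hab : a ≠ b)
    (n₀ : ℕ) (hn₀ : n₀ = 0 ∨ n₀ = 1)
    (f : ℕ → ℕ) (hf : StrictMonoOn f (Set.Ici n₀))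
    (hL : IsDescribedByGF2Grammar
      ({w | ∃ n : ℕ, n₀ ≤ n ∧ w = List.replicate n a ++ List.replicate (f n) b} : Language T)) :
    IsFiniteUnionOfArithmeticProgressions (f '' Set.Ici n₀) :=
  theorem3p4_general hab hf.injOn hL
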